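/- \textbf{Setting.} In the \textsc{CongestedClique} on $n$ machines $0,\dots,n-1$ (one per vertex), in every synchronous round each machine does unrestricted local computation, using private independent randomness, and sends a message of at most $c\lceil\log_2(n+1)\rceil$ bits to each machine, where $c\ge 1$ is a constant integer. A \emph{local Gibbs distribution} on a graph $G=(V,E)$ consists of a set $\mathcal S$ of labelings $V\to\mathcal A$ and a Hamiltonian $H:\mathcal S\to\{0,\dots,h\}$ that is a sum of vertex functions and edge functions with values in $\{0,\dots,h\}$, such that for each inverse temperature $\beta$ the law $\sigma\mapsto e^{-\beta H(\sigma)}/Z(\beta)$ on $\mathcal S$, where $Z(\beta)=\sum_{\sigma\in\mathcal S}e^{-\beta H(\sigma)}$, is a pairwise Markov random field $\propto\prod_v b_v(l(v))\prod_{e=\{u,v\}\in E}A_e(l(u),l(v))$; moreover $|\mathcal A|$ and $h$ are polynomially bounded in $n$, and an element of $\mathcal S$ can be constructed in $O(\log n)$ rounds. $Z(\infty)$ is the limit of $Z(\beta)$ as $\beta\to\infty$. One transition of the \emph{distributed Metropolis--Hastings chain} with activation probability $q$: every vertex is independently active with probability $q$, and an active $v$ proposes a label $\sigma_v$ with law proportional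 to $b_v$; every edge $\{u,v\}$ is independently accepted with probability $\frac{A_e(X_u,\sigma_v)}{\max A_e}\cdot\frac{A_e(\sigma_u,X_v)}{\max A_e}\cdot\frac{A_e(\sigma_u,\sigma_v)}{\max A_e}$ (factors involving an inactive vertex's proposal are $1$); every active vertex all of whose edges are accepted takes its proposal. For a graph $G=(V,E)$ with $n$ vertices, let $\mathcal A=V\cup[3n]$ (disjoint union), let $\mathcal S_G$ be the set of labelings in which the label of every vertex lies in $[3n]$ or is a neighbour of that vertex, let $H_G(\sigma)$ be the number of edges whose two endpoints are labeled by the same vertex, and let $Z_G$ be the partition function. \textbf{Theorem.} \begin{enumerate} \item These are local Gibbs distributions. \item They are fast mixing over all $\beta\ge 0$: there are constants $0<q<1$ and $C>0$ such that for all $n\ge1$, all $G$, all $\beta\in[0,\infty]$, all initial labelings in $\mathcal S_G$ and all $0<\delta<1$, the distributed Metropolis--Hastings chain with activation probability $q$ is within total variation distance $\delta$ of the Gibbs distribution after any $t\ge C\log(n/\delta)$ transitions. \item $Z_G(0)=\prod_{v}(3n+\deg v)$. \item Approximating their partition functions is as hard as triangle detection: let $n\ge 1$, $c\ge1$, $T\ge0$,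 $p\in\mathbb R$ and $0<\varepsilon\le\frac1{32n^2}$. Suppose that some \textsc{CongestedClique} algorithm with $c\lceil\log_2(n+1)\rceil$-bit messages and at most $T$ rounds, in which every machine is given its vertex's portion of the input (its neighbours and its vertex and edge functions) and the number $Z_G(0)$, has the following property: for every graph $G$ on $n$ vertices, with probability at least $p$, a designated machine outputs some $\bar Z$ with $(1-\varepsilon)Z_G(\infty)\le\bar Z\le(1+\varepsilon)Z_G(\infty)$. Then some \textsc{CongestedClique} algorithm with $c\lceil\log_2(n+1)\rceil$-bit messages and at most $T+2$ rounds, in which every machine is given only the neighbours of its vertex, has the following property: for every graph $G$ on $n$ vertices, with probability at least $p$, all machines correctly output whether $G$ contains a triangle. \end{enumerate} Consequently, approximating the partition function of a general local Gibbs distribution to within $\varepsilon\le\frac1{32n^2}$ with success probability $p$ is as hard as triangle detection with success probability $p$, even when $Z(0)$ is known and the chain is fast mixing over all $\beta\ge0$. -/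

import Mathlib

open MeasureTheory Filter Topology
open scoped NNReal ENNReal

noncomputable section

namespace GibbsCC

/-! ### The congested clique -/

/-- A message in the congested clique on `n` machines: `c * ⌈log₂ (n + 1)⌉` bits. -/
abbrev Message (n c : ℕ) : Type := Fin (c * Nat.clog 2 (n + 1)) → Bool

/-- A randomized congested clique algorithm on machines `0, …, n - 1` with messages of
`c * ⌈log₂ (n + 1)⌉` bits. Every machine holds an input from `In` and a private random seed; the
seeds are independent. Local computation is unrestricted, so what a machine sends in a round, and
what it finally outputs, is an arbitrary function of its ID, its input, its seed, and the list of
all messages that it has received so far (one entry per past round, indexed by the sender). -/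
structure Algorithm (n c : ℕ) (In : Type) (Out : Type) [MeasurableSpace Out] where
  Seed : Type
  [seedSpace : MeasurableSpace Seed]
  seedLaw : Measure Seed
  [seedProb : IsProbabilityMeasure seedLaw]
  rounds : ℕ
  send : Fin n → In → Seed → List (Fin n → Message n c) → Fin n → Message n c
  out : Fin n → In → Seed → List (Fin n → Message n c) → Out
  measurable_send : ∀ v x hist w, Measurable fun s => send v x s hist w
  measurable_out : ∀ v x hist, Measurable fun s => out v x s hist

attribute [instance] Algorithm.seedSpace Algorithm.seedProb

namespace Algorithm

variable {n c : ℕ} {In Out : Type} [MeasurableSpace Out]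

/-- The messages that machine `v` has received in the first `t` rounds, oldest first. -/
def received (P : Algorithm n c In Out) (x : Fin n → In) (s : Fin n → P.Seed) :
    ℕ → Fin n → List (Fin n → Message n c)
  | 0, _ => []
  | t + 1, v => received P x s t v ++ [fun u => P.send u (x u) (s u) (received P x s t u) v]

/-- The output of machine `v` after the last round. -/
def output (P : Algorithm n c In Out) (x : Fin n → In) (s : Fin n → P.Seed) (v : Fin n) : Out :=
  P.out v (x v) (s v) (P.received x s P.rounds v)

/-- The probability, over the independent seeds, that the vector of outputs lies in `good`. -/
def successProb (P : Algorithm n c In Out) (x : Fin n → In) (good : Set (Fin n → Out)) : ℝ :=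
  (Measure.pi fun _ : Fin n => P.seedLaw).real {s | P.output x s ∈ good}

end Algorithm

/-! ### Gibbs distributions -/

/-- The factor `λ = exp (-β)` of an inverse temperature `β ∈ [0, ∞]`, with `exp (-∞) = 0`. -/
def expNeg (β : ℝ≥0∞) : ℝ≥0 := if β = ⊤ then 0 else Real.toNNReal (Real.exp (-β.toReal))

/-- A set `S` of labelings of the vertices `0, …, n - 1` with a Hamiltonian `H : S → {0, …, h}`. -/
structure GibbsDistribution (n : ℕ) (𝒜 : Type) where
  S : Finset (Fin n → 𝒜)
  S_nonempty : S.Nonempty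
  h : ℕ
  H : (Fin n → 𝒜) → ℕ
  H_le : ∀ σ ∈ S, H σ ≤ h

namespace GibbsDistribution

variable {n : ℕ} {𝒜 : Type}

/-- `Z(β) = ∑_{σ ∈ S} exp (-β H(σ))`. At `β = ∞` this is the number of `σ ∈ S` with `H(σ) = 0`,
the limit of `Z(β)` as `β → ∞` (see `tendsto_Z`). -/
def Z (D : GibbsDistribution n 𝒜) (β : ℝ≥0∞) : ℝ := ∑ σ ∈ D.S, (expNeg β : ℝ) ^ D.H σ

theorem tendsto_Z (D : GibbsDistribution n 𝒜) :
    Tendsto (fun β : ℝ => D.Z (ENNReal.ofReal β)) atTop (𝓝 (D.Z ⊤)) := by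
  unfold Z
  refine tendsto_finsetSum _ fun σ _ => Tendsto.pow ?_ _
  have h : Tendsto (fun β : ℝ => Real.exp (-β)) atTop (𝓝 0) := Real.tendsto_exp_neg_atTop_nhds_zero
  have h0 : ((expNeg ⊤ : ℝ≥0) : ℝ) = 0 := by simp [expNeg]
  rw [h0]
  refine h.congr' ?_
  filter_upwards [eventually_ge_atTop 0] with β hβ
  simp [expNeg, ENNReal.toReal_ofReal hβ, Real.exp_nonneg]

theorem Z_eq_sum_exp (D : GibbsDistribution n 𝒜) (β : ℝ≥0) :
    D.Z β = ∑ σ ∈ D.S, Real.exp (-(β : ℝ) * D.H σ) := by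
  unfold Z
  refine Finset.sum_congr rfl fun σ _ => ?_
  simp [expNeg, Real.exp_nonneg, ← Real.exp_nat_mul, mul_comm]

open Classical in
/-- The probability of a labeling under the Gibbs distribution at inverse temperature `β`
(meaningful when `Z(β) ≠ 0`, which is automatic for finite `β`). -/
def prob (D : GibbsDistribution n 𝒜) (β : ℝ≥0∞) (σ : Fin n → 𝒜) : ℝ :=
  if σ ∈ D.S then (expNeg β : ℝ) ^ D.H σ / D.Z β else 0

end GibbsDistribution

/-! ### Pairwise Markov random fields and the distributed Metropolis-Hastings chain -/

open Classical in
/-- The edges of `G`, each listed once as a pair `(u, v)` with `u < v`. -/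
def edges {n : ℕ} (G : SimpleGraph (Fin n)) : Finset (Fin n × Fin n) :=
  Finset.univ.filter fun e => e.1 < e.2 ∧ G.Adj e.1 e.2

/-- Vertex constraints `b v` and, for every edge `e = {u, v}`, the constraint `A_e`, which is
`A u v` when its first argument is the label of `u`, and `A v u` when it is the label of `v`. -/
structure PairwiseMRF {n : ℕ} (G : SimpleGraph (Fin n)) (𝒜 : Type) where
  b : Fin n → 𝒜 → ℝ≥0
  A : Fin n → Fin n → 𝒜 → 𝒜 → ℝ≥0
  A_symm : ∀ u v x y, A u v x y = A v u y x

namespace PairwiseMRF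

variable {n : ℕ} {G : SimpleGraph (Fin n)} {𝒜 : Type}

def weight (M : PairwiseMRF G 𝒜) (l : Fin n → 𝒜) : ℝ :=
  (∏ v, (M.b v (l v) : ℝ)) * ∏ e ∈ edges G, (M.A e.1 e.2 (l e.1) (l e.2) : ℝ)

variable [Fintype 𝒜]

/-- The random field has the law `μ`. -/
def Represents (M : PairwiseMRF G 𝒜) (μ : (Fin n → 𝒜) → ℝ) : Prop :=
  (∑ l, M.weight l) ≠ 0 ∧ ∀ l, μ l = M.weight l / ∑ l', M.weight l'

/-- The law of the proposal of `v`: none with probability `1 - p` (then `v` is inactive), and else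
a label drawn proportionally to `b v`. -/
def proposalProb (M : PairwiseMRF G 𝒜) (p : ℝ) (v : Fin n) : Option 𝒜 → ℝ
  | none => 1 - p
  | some a => p * ((M.b v a : ℝ) / ∑ x, (M.b v x : ℝ))

/-- `A_e(x, y) / max A_e`, read as `1` if one of the labels is missing. -/
def ratio (M : PairwiseMRF G 𝒜) (u v : Fin n) : Option 𝒜 → Option 𝒜 → ℝ
  | some x, some y => (M.A u v x y : ℝ) /
      ((Finset.univ.sup fun z : 𝒜 × 𝒜 => M.A u v z.1 z.2 : ℝ≥0) : ℝ)
  | _, _ => 1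

/-- The probability that the edge `e` is accepted, given the current labeling `X` and the
proposals `σ`. -/
def acceptProb (M : PairwiseMRF G 𝒜) (X : Fin n → 𝒜) (σ : Fin n → Option 𝒜)
    (e : Fin n × Fin n) : ℝ :=
  M.ratio e.1 e.2 (some (X e.1)) (σ e.2) * M.ratio e.1 e.2 (σ e.1) (some (X e.2)) *
    M.ratio e.1 e.2 (σ e.1) (σ e.2)

open Classical in
/-- The new labeling if `F` is the set of accepted edges: an active vertex takes its proposal if
all its edges are accepted. -/
def update (G : SimpleGraph (Fin n)) (X : Fin n → 𝒜) (σ : Fin n → Option 𝒜)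
    (F : Finset (Fin n × Fin n)) : Fin n → 𝒜 := fun v =>
  if ∀ e ∈ edges G, e.1 = v ∨ e.2 = v → e ∈ F then (σ v).getD (X v) else X v

open Classical in
/-- The transition matrix of the distributed Metropolis-Hastings chain with activation
probability `p`. -/
def transition (M : PairwiseMRF G 𝒜) (p : ℝ) : Matrix (Fin n → 𝒜) (Fin n → 𝒜) ℝ := fun X Y =>
  ∑ σ : Fin n → Option 𝒜, (∏ v, M.proposalProb p v (σ v)) *
    ∑ F ∈ (edges G).powerset,
      (∏ e ∈ F, M.acceptProb X σ e) * (∏ e ∈ edges G \ F, (1 - M.acceptProb X σ e)) *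
        if update G X σ F = Y then 1 else 0

open Classical in
/-- Total variation distance between the chain started at `X`, after `t` transitions, and `μ`. -/
def tvDist (M : PairwiseMRF G 𝒜) (p : ℝ) (t : ℕ) (X : Fin n → 𝒜) (μ : (Fin n → 𝒜) → ℝ) : ℝ :=
  (1 / 2) * ∑ Y, |(M.transition p ^ t) X Y - μ Y|

end PairwiseMRF

/-! ### Local Gibbs distributions -/

/-- A Gibbs distribution on a graph, with its representation as a pairwise Markov random field
at every inverse temperature `β ∈ [0, ∞]` at which it is defined, and with its Hamiltonian
written as a sum of vertex and edge functions with values in `{0, …, h}`. -/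
structure LocalGibbs (n : ℕ) (𝒜 : Type) [Fintype 𝒜] extends GibbsDistribution n 𝒜 where
  graph : SimpleGraph (Fin n)
  mrf : ℝ≥0∞ → PairwiseMRF graph 𝒜
  mrf_represents : ∀ β, toGibbsDistribution.Z β ≠ 0 →
    (mrf β).Represents (toGibbsDistribution.prob β)
  Hv : Fin n → 𝒜 → ℕ
  He : Fin n → Fin n → 𝒜 → 𝒜 → ℕ
  He_symm : ∀ u v x y, He u v x y = He v u y x
  Hv_le : ∀ v x, Hv v x ≤ h
  He_le : ∀ u v x y, graph.Adj u v → He u v x y ≤ h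
  H_eq : ∀ σ ∈ S, H σ = ∑ v, Hv v (σ v) + ∑ e ∈ edges graph, He e.1 e.2 (σ e.1) (σ e.2)

/-- The portion of the input that a single machine holds: the neighbours of its vertex, and the
vertex and edge functions at its vertex (edge functions are `0` at non-neighbours). -/
structure LocalView (n : ℕ) (𝒜 : Type) where
  nbrs : Set (Fin n)
  h : ℕ
  b : ℝ≥0∞ → 𝒜 → ℝ≥0
  A : ℝ≥0∞ → Fin n → 𝒜 → 𝒜 → ℝ≥0
  Hv : 𝒜 → ℕ
  He : Fin n → 𝒜 → 𝒜 → ℕ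

open Classical in
def LocalGibbs.view {n : ℕ} {𝒜 : Type} [Fintype 𝒜] (D : LocalGibbs n 𝒜) (v : Fin n) :
    LocalView n 𝒜 where
  nbrs := D.graph.neighborSet v
  h := D.h
  b := fun β => (D.mrf β).b v
  A := fun β u x y => if D.graph.Adj v u then (D.mrf β).A v u x y else 0
  Hv := D.Hv v
  He := fun u x y => if D.graph.Adj v u then D.He v u x y else 0

/-- A class of Gibbs distributions, such as a Potts model: for every `n`, a set of instances. -/
abbrev Model (𝒜 : ℕ → Type) [∀ n, Fintype (𝒜 n)] : Type := ∀ n, Set (LocalGibbs n (𝒜 n))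

section Model

variable {𝒜 : ℕ → Type} [∀ n, Fintype (𝒜 n)]

/-- The size of the alphabet and the range of the Hamiltonian are polynomially bounded in `n`. -/
def PolyBounded (𝓜 : Model 𝒜) : Prop :=
  ∃ k : ℕ, ∀ n, Fintype.card (𝒜 n) ≤ k * n ^ k + k ∧ ∀ D ∈ 𝓜 n, D.h ≤ k * n ^ k + k

/-- An element of `S` can be constructed in `O(log n)` rounds of the congested clique, every
machine finding the label of its vertex. -/
def Constructible (𝓜 : Model 𝒜) : Prop :=
  ∃ c C : ℕ, ∀ n, 1 ≤ n →
    letI : MeasurableSpace (𝒜 n) := ⊤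
    ∃ P : Algorithm n c (LocalView n (𝒜 n)) (𝒜 n),
      P.rounds ≤ C * Nat.clog 2 n + C ∧
      ∀ D ∈ 𝓜 n, P.successProb D.view {σ | σ ∈ D.S} = 1

/-- The model consists of local Gibbs distributions with polynomially bounded parameters. (The
random field and the decomposition of the Hamiltonian are part of `LocalGibbs`.) -/
def IsLocalModel (𝓜 : Model 𝒜) : Prop := PolyBounded 𝓜 ∧ Constructible 𝓜

/-- The distributed Metropolis-Hastings chain, with a suitable constant activation probability,
is within total variation distance `δ` of the Gibbs distribution after `O(log (n / δ))`
transitions from any element of `S`, uniformly over all inverse temperatures `β ∈ [0, ∞]`. -/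
def FastMixing (𝓜 : Model 𝒜) : Prop :=
  ∃ p C : ℝ, 0 < p ∧ p < 1 ∧ 0 < C ∧
    ∀ n, 1 ≤ n → ∀ D ∈ 𝓜 n, ∀ β : ℝ≥0∞, D.Z β ≠ 0 → ∀ X ∈ D.S, ∀ δ : ℝ, 0 < δ → δ < 1 →
      ∀ t : ℕ, C * Real.log (n / δ) ≤ t → (D.mrf β).tvDist p t X (D.prob β) ≤ δ

/-- Some congested clique algorithm with `c * ⌈log₂ (n + 1)⌉`-bit messages and at most `T` rounds
approximates `Z(β)` within a factor `1 ± ε` with probability at least `p` on each instance of size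
`n`, when every machine is given its portion of the input and the number `Z(0)`. Only one
designated machine has to find the approximation. -/
def ApproximableKnowingZ0 (𝓜 : Model 𝒜) (β : ℝ≥0∞) (ε p : ℝ) (n c T : ℕ) : Prop :=
  ∃ (P : Algorithm n c (LocalView n (𝒜 n) × ℝ) ℝ) (leader : Fin n), P.rounds ≤ T ∧
    ∀ D ∈ 𝓜 n, p ≤ P.successProb (fun v => (D.view v, D.Z 0))
      {z | (1 - ε) * D.Z β ≤ z leader ∧ z leader ≤ (1 + ε) * D.Z β}

end Model

/-- Some congested clique algorithm with `c * ⌈log₂ (n + 1)⌉`-bit messages and at most `T` rounds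
decides with probability at least `p` on each graph with `n` vertices whether it contains a
triangle; every machine initially knows the neighbours of its vertex, and finds the answer. -/
def TriangleDetectable (p : ℝ) (n c T : ℕ) : Prop :=
  ∃ P : Algorithm n c (Set (Fin n)) Bool, P.rounds ≤ T ∧
    ∀ G : SimpleGraph (Fin n), p ≤ P.successProb (fun v => G.neighborSet v)
      {z | ∀ v, z v = true ↔ ¬ G.CliqueFree 3}

/-! ### The neighbour labeling model -/

/-- The alphabet `V ∪ [3n]`. -/
abbrev NbrLabel (n : ℕ) : Type := Fin n ⊕ Fin (3 * n)

section NbrModel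

variable {n : ℕ} (G : SimpleGraph (Fin n))

open Classical in
/-- Labelings in which the label of every vertex is in `[3n]` or is a neighbour; the Hamiltonian
counts the edges whose two ends have the same vertex as label. -/
def nbrGibbs : GibbsDistribution n (NbrLabel n) where
  S := Finset.univ.filter fun σ => ∀ v w, σ v = Sum.inl w → G.Adj v w
  S_nonempty := ⟨fun v => Sum.inr ⟨v, by omega⟩, by simp⟩
  h := n ^ 2
  H := fun σ => ((edges G).filter fun e => ∃ w, σ e.1 = Sum.inl w ∧ σ e.2 = Sum.inl w).card
  H_le := by
    intro σ _
    refine (Finset.card_le_univ _).trans ?_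
    simp [sq]

open Classical in
/-- The random field of `nbrGibbs G`: vertex constraints select the admissible labels, and an edge
has the factor `exp (-β)` if its two ends have the same vertex as label. -/
def nbrMRF (β : ℝ≥0∞) : PairwiseMRF G (NbrLabel n) where
  b := fun v x => if ∀ w, x = Sum.inl w → G.Adj v w then 1 else 0
  A := fun _ _ x y => if ∃ w, x = Sum.inl w ∧ y = Sum.inl w then expNeg β else 1
  A_symm := by
    intro u v x y
    simp only [and_comm]

theorem nbrMRF_weight (β : ℝ≥0∞) (l : Fin n → NbrLabel n) :
    (nbrMRF G β).weight l =
      if l ∈ (nbrGibbs G).S then (expNeg β : ℝ) ^ (nbrGibbs G).H l else 0 := by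
  classical
  have hE : (∏ e ∈ edges G, ((nbrMRF G β).A e.1 e.2 (l e.1) (l e.2) : ℝ)) =
      (expNeg β : ℝ) ^ (nbrGibbs G).H l := by
    simp only [nbrMRF, nbrGibbs]
    rw [← Finset.prod_const, Finset.prod_filter]
    refine Finset.prod_congr rfl fun e _ => ?_
    split_ifs <;> simp
  unfold PairwiseMRF.weight
  rw [hE]
  by_cases hl : ∀ v w, l v = Sum.inl w → G.Adj v w
  · have h1 : l ∈ (nbrGibbs G).S := by simpa [nbrGibbs] using hl
    have h2 : (∏ v, ((nbrMRF G β).b v (l v) : ℝ)) = 1 := by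
      refine Finset.prod_eq_one fun v _ => ?_
      simp only [nbrMRF, if_pos (hl v), NNReal.coe_one]
    rw [if_pos h1, h2, one_mul]
  · have h1 : l ∉ (nbrGibbs G).S := by simpa [nbrGibbs] using hl
    obtain ⟨v, hv⟩ := not_forall.mp hl
    have h2 : (∏ v, ((nbrMRF G β).b v (l v) : ℝ)) = 0 := by
      refine Finset.prod_eq_zero (Finset.mem_univ v) ?_
      simp only [nbrMRF, if_neg hv, NNReal.coe_zero]
    rw [if_neg h1, h2, zero_mul]

theorem sum_nbrMRF_weight (β : ℝ≥0∞) :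
    ∑ l, (nbrMRF G β).weight l = (nbrGibbs G).Z β := by
  classical
  simp only [nbrMRF_weight, GibbsDistribution.Z]
  rw [← Finset.sum_filter]
  simp

open Classical in
/-- `nbrGibbs G` with its local structure. -/
def nbrLocalGibbs : LocalGibbs n (NbrLabel n) where
  toGibbsDistribution := nbrGibbs G
  graph := G
  mrf := nbrMRF G
  mrf_represents := by
    intro β hβ
    refine ⟨by rwa [sum_nbrMRF_weight], fun l => ?_⟩
    rw [sum_nbrMRF_weight, nbrMRF_weight, GibbsDistribution.prob]
    split_ifs <;> simp
  Hv := fun _ _ => 0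
  He := fun _ _ x y => if ∃ w, x = Sum.inl w ∧ y = Sum.inl w then 1 else 0
  He_symm := by
    intro u v x y
    simp only [and_comm]
  Hv_le := fun _ _ => Nat.zero_le _
  He_le := by
    intro u _ x y _
    have : 1 ≤ n ^ 2 := Nat.one_le_pow _ _ (Fin.pos u)
    show _ ≤ n ^ 2
    split_ifs <;> omega
  H_eq := by
    intro σ _
    simp [nbrGibbs, Finset.sum_boole]

end NbrModel

/-- The neighbour labeling distributions of all graphs. -/
def nbrModel : Model NbrLabel := fun _ => Set.range nbrLocalGibbs

end GibbsCC

end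

open GibbsCC

/-! Hardness. Two adjacent vertices `a`, `b` can both be labeled `c` only if `a`, `b`, `c` form a
triangle. Without triangles the Hamiltonian vanishes on `S`, so Z(∞) = Z(0). With a triangle, the
labelings that give `c` to both `a` and `b` are a fraction 1/((3n + deg a)(3n + deg b)) ≥ 1/(16n²)
of `S`, and all of them are lost at β = ∞. A relative error of at most 1/(32n²) separates the two
cases (`lt_iff_not_cliqueFree`). Since Z(0) depends only on the degrees, one round of broadcasts
makes it known to everybody; a last round spreads the leader's verdict (`detector_output`).

Mixing. Labels in [3n] never conflict with anything, at any β. Take two labelings that differ only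
at `v`, and couple their transitions with the same proposals. The difference spreads only to
neighbours of `v` that propose one of the two labels of `v`, on average at most 2q/3 of them for
activation probability q, because every label is proposed with probability at most q/(3n). If no
neighbour does so and `v` proposes a label in [3n], which has probability at least 3q/4, then the
chains meet. For small q the gain wins, uniformly in β (`nbrMRF_contraction`).

The coupling is carried out dually: one transition contracts Lipschitz constants of functions with
respect to Hamming distance. Together with stationarity, proved by a weight-preserving involution
(`sum_weight_mul_transition`), this bounds the total variation distance
(`tvDist_le_of_contraction`). -/

namespace GibbsCC

/-! ### Random subsets -/

section Bernoulli

variable {ι : Type*} [DecidableEq ι]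

/-- The expectation of `g F` for a random subset `F` of `E` that contains each `e ∈ E`
independently with probability `p e`. -/
noncomputable def bernoulliSum (E : Finset ι) (p : ι → ℝ) (g : Finset ι → ℝ) : ℝ :=
  ∑ F ∈ E.powerset, (∏ e ∈ F, p e) * (∏ e ∈ E \ F, (1 - p e)) * g F

theorem bernoulliSum_insert {E : Finset ι} {e : ι} (he : e ∉ E) (p : ι → ℝ)
    (g : Finset ι → ℝ) :
    bernoulliSum (insert e E) p g =
      p e * bernoulliSum E p (fun F => g (insert e F)) + (1 - p e) * bernoulliSum E p g := by
  unfold bernoulliSum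
  rw [Finset.sum_powerset_insert he, add_comm, Finset.mul_sum, Finset.mul_sum]
  congr 1
  · refine Finset.sum_congr rfl fun F hF => ?_
    have hF' : e ∉ F := fun h => he (Finset.mem_powerset.mp hF h)
    have h1 : insert e E \ insert e F = E \ F := by
      ext x; simp only [Finset.mem_sdiff, Finset.mem_insert]
      constructor
      · rintro ⟨h | h, h'⟩ <;> tauto
      · rintro ⟨h, h'⟩
        exact ⟨Or.inr h, by rintro (rfl | h2) <;> tauto⟩
    rw [Finset.prod_insert hF', h1]
    ring
  · refine Finset.sum_congr rfl fun F hF => ?_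
    have hF' : e ∉ F := fun h => he (Finset.mem_powerset.mp hF h)
    rw [Finset.insert_sdiff_of_notMem _ hF', Finset.prod_insert (by simp [he])]
    ring

theorem bernoulliSum_const (E : Finset ι) (p : ι → ℝ) (c : ℝ) :
    bernoulliSum E p (fun _ => c) = c := by
  induction E using Finset.induction_on with
  | empty => simp [bernoulliSum]
  | insert e E he ih => rw [bernoulliSum_insert he, ih]; ring

/-- Two biased coins tossed independently: the difference of the means is the average of the four
differences, with the product weights. -/
theorem abs_convex_sub_le {s t a b a' b' c : ℝ} (hs : 0 ≤ s) (hs1 : s ≤ 1) (ht : 0 ≤ t)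
    (ht1 : t ≤ 1) (h1 : |a - a'| ≤ c) (h2 : |a - b'| ≤ c) (h3 : |b - a'| ≤ c)
    (h4 : |b - b'| ≤ c) :
    |(s * a + (1 - s) * b) - (t * a' + (1 - t) * b')| ≤ c := by
  have hs' : 0 ≤ 1 - s := by linarith
  have ht' : 0 ≤ 1 - t := by linarith
  rw [abs_le] at *
  have e : (s * a + (1 - s) * b) - (t * a' + (1 - t) * b') =
      s * t * (a - a') + s * (1 - t) * (a - b') + (1 - s) * t * (b - a') +
        (1 - s) * (1 - t) * (b - b') := by ring
  have m1 := mul_nonneg hs ht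
  have m2 := mul_nonneg hs ht'
  have m3 := mul_nonneg hs' ht
  have m4 := mul_nonneg hs' ht'
  rw [e]
  constructor
  · have := mul_le_mul_of_nonneg_left h1.1 m1
    have := mul_le_mul_of_nonneg_left h2.1 m2
    have := mul_le_mul_of_nonneg_left h3.1 m3
    have := mul_le_mul_of_nonneg_left h4.1 m4
    linarith
  · have := mul_le_mul_of_nonneg_left h1.2 m1
    have := mul_le_mul_of_nonneg_left h2.2 m2
    have := mul_le_mul_of_nonneg_left h3.2 m3
    have := mul_le_mul_of_nonneg_left h4.2 m4
    linarith

/-- Two random subsets whose laws agree outside `B` can be coupled so that they agree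
outside `B`. -/
theorem abs_bernoulliSum_sub_le (E B : Finset ι) (p p' : ι → ℝ) (g g' : Finset ι → ℝ) (c : ℝ)
    (hp : ∀ e, 0 ≤ p e ∧ p e ≤ 1) (hp' : ∀ e, 0 ≤ p' e ∧ p' e ≤ 1)
    (hpp : ∀ e ∈ E, e ∉ B → p e = p' e)
    (hg : ∀ F F', (∀ e, e ∉ B → (e ∈ F ↔ e ∈ F')) → |g F - g' F'| ≤ c) :
    |bernoulliSum E p g - bernoulliSum E p' g'| ≤ c := by
  induction E using Finset.induction_on generalizing g g' with
  | empty => simpa [bernoulliSum] using hg ∅ ∅ (by simp)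
  | insert e E he ih =>
    have hE : ∀ e ∈ E, e ∉ B → p e = p' e := fun x hx => hpp x (Finset.mem_insert_of_mem hx)
    rw [bernoulliSum_insert he, bernoulliSum_insert he]
    have h1 := ih (fun F => g (insert e F)) (fun F => g' (insert e F)) hE fun F F' h =>
      hg _ _ fun x hx => by simp [h x hx]
    have h4 := ih g g' hE hg
    -- The coupling tosses independent coins for `e ∈ B`, where all four outcomes must be
    -- controlled, and one common coin for `e ∉ B`.
    by_cases heB : e ∈ B
    · have h2 := ih (fun F => g (insert e F)) g' hE fun F F' h =>
        hg _ _ fun x hx => by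
          have : x ≠ e := by rintro rfl; exact hx heB
          simp [h x hx, this]
      have h3 := ih g (fun F => g' (insert e F)) hE fun F F' h =>
        hg _ _ fun x hx => by
          have : x ≠ e := by rintro rfl; exact hx heB
          simp [h x hx, this]
      exact abs_convex_sub_le (hp e).1 (hp e).2 (hp' e).1 (hp' e).2 h1 h2 h3 h4
    · rw [← hpp e (Finset.mem_insert_self _ _) heB]
      have hs := (hp e).1
      have hs' : 0 ≤ 1 - p e := by linarith [(hp e).2]
      rw [abs_le] at *
      constructor
      · have := mul_le_mul_of_nonneg_left h1.1 hs
        have := mul_le_mul_of_nonneg_left h4.1 hs'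
        linarith
      · have := mul_le_mul_of_nonneg_left h1.2 hs
        have := mul_le_mul_of_nonneg_left h4.2 hs'
        linarith

/-- A set that misses an element of probability one has weight zero, so the integrands need to agree
only on the remaining sets. -/
theorem bernoulliSum_congr_of_eq_one {E : Finset ι} {p p' : ι → ℝ} {g g' : Finset ι → ℝ}
    (hpp : ∀ e ∈ E, p e = p' e)
    (hg : ∀ F, (∀ e ∈ E, p e = 1 → e ∈ F) → g F = g' F) :
    bernoulliSum E p g = bernoulliSum E p' g' := by
  unfold bernoulliSum
  refine Finset.sum_congr rfl fun F hF => ?_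
  rw [Finset.mem_powerset] at hF
  rw [← Finset.prod_congr rfl fun e he => hpp e (hF he),
    ← Finset.prod_congr rfl fun e he => congrArg (1 - ·) (hpp e (Finset.mem_sdiff.mp he).1)]
  by_cases h : ∀ e ∈ E, p e = 1 → e ∈ F
  · rw [hg F h]
  · push Not at h
    obtain ⟨e, he, hpe, heF⟩ := h
    have : ∏ e ∈ E \ F, (1 - p e) = 0 :=
      Finset.prod_eq_zero (Finset.mem_sdiff.mpr ⟨he, heF⟩) (by simp [hpe])
    simp [this]

end Bernoulli

/-! ### Expectations over independent labels -/

section ProductLaw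

variable {V α : Type*} [Fintype V] [DecidableEq V] [Fintype α]

theorem sum_prod_mul_prod (p ψ : V → α → ℝ) :
    ∑ σ : V → α, (∏ v, p v (σ v)) * ∏ v, ψ v (σ v) = ∏ v, ∑ a, p v a * ψ v a := by
  rw [Finset.prod_univ_sum]
  simp [Finset.prod_mul_distrib]

theorem sum_prod_eq_one {p : V → α → ℝ} (hp : ∀ v, ∑ a, p v a = 1) :
    ∑ σ : V → α, ∏ v, p v (σ v) = 1 := by
  have := sum_prod_mul_prod p fun _ _ => 1
  simpa [hp] using this

theorem sum_prod_mul_apply {p : V → α → ℝ} (hp : ∀ v, ∑ a, p v a = 1) (u : V) (g : α → ℝ) :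
    ∑ σ : V → α, (∏ v, p v (σ v)) * g (σ u) = ∑ a, p u a * g a := by
  have := sum_prod_mul_prod p fun v a => if v = u then g a else 1
  simp only [Finset.prod_ite_eq', Finset.mem_univ, if_true] at this
  rw [this, Finset.prod_eq_single u]
  · simp
  · intro v _ hv
    simp [hv, hp]
  · simp

theorem sum_prod_mul_apply_mul_apply {p : V → α → ℝ} (hp : ∀ v, ∑ a, p v a = 1) {u w : V}
    (huw : u ≠ w) (g h : α → ℝ) :
    ∑ σ : V → α, (∏ v, p v (σ v)) * (g (σ u) * h (σ w)) =
      (∑ a, p u a * g a) * ∑ a, p w a * h a := by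
  have := sum_prod_mul_prod p fun v a => (if v = u then g a else 1) * (if v = w then h a else 1)
  simp only [Finset.prod_mul_distrib, Finset.prod_ite_eq', Finset.mem_univ, if_true] at this
  rw [this, Finset.prod_eq_mul u w huw]
  · simp [huw, huw.symm]
  · rintro v - ⟨hv, hv'⟩
    simp [hv, hv', hp]
  · simp
  · simp

end ProductLaw

/-! ### Proposal and acceptance probabilities, and the transition operator on functions -/

namespace PairwiseMRF

variable {n : ℕ} {G : SimpleGraph (Fin n)} {𝒜 : Type} [Fintype 𝒜] (M : PairwiseMRF G 𝒜)

theorem ratio_nonneg (u v : Fin n) (x y : Option 𝒜) : 0 ≤ M.ratio u v x y := by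
  rcases x with _ | x <;> rcases y with _ | y <;> simp only [ratio] <;> positivity

theorem ratio_le_one (u v : Fin n) (x y : Option 𝒜) : M.ratio u v x y ≤ 1 := by
  rcases x with _ | x <;> rcases y with _ | y <;> simp only [ratio, le_refl]
  refine div_le_one_of_le₀ ?_ (by positivity)
  rw [NNReal.coe_le_coe]
  exact Finset.le_sup (f := fun z : 𝒜 × 𝒜 => M.A u v z.1 z.2) (Finset.mem_univ (x, y))

theorem acceptProb_mem (X : Fin n → 𝒜) (σ : Fin n → Option 𝒜) (e : Fin n × Fin n) :
    0 ≤ M.acceptProb X σ e ∧ M.acceptProb X σ e ≤ 1 := by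
  have := M.ratio_nonneg e.1 e.2
  have := M.ratio_le_one e.1 e.2
  unfold acceptProb
  constructor
  · exact mul_nonneg (mul_nonneg (by simp [*]) (by simp [*])) (by simp [*])
  · refine mul_le_one₀ (mul_le_one₀ ?_ ?_ ?_) ?_ ?_ <;> simp [*]

theorem proposalProb_nonneg {p : ℝ} (hp : 0 ≤ p) (hp1 : p ≤ 1) (v : Fin n) (a : Option 𝒜) :
    0 ≤ M.proposalProb p v a := by
  rcases a with _ | a <;> simp only [proposalProb]
  · linarith
  · positivity

theorem sum_proposalProb (p : ℝ) {v : Fin n} (hv : ∑ x, (M.b v x : ℝ) ≠ 0) :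
    ∑ a, M.proposalProb p v a = 1 := by
  rw [Fintype.sum_option]
  simp only [proposalProb]
  rw [← Finset.mul_sum, ← Finset.sum_div, div_self hv]
  ring

-- The dual form of the chain: an expectation over proposals and then over accepted edges.
-- Stationarity and contraction are both tested against functions in this form, so no joint law of
-- two chains has to be built.
open Classical in
theorem transition_mulVec (p : ℝ) (f : (Fin n → 𝒜) → ℝ) (X : Fin n → 𝒜) :
    (M.transition p).mulVec f X = ∑ σ : Fin n → Option 𝒜, (∏ v, M.proposalProb p v (σ v)) *
      bernoulliSum (edges G) (M.acceptProb X σ) (fun F => f (update G X σ F)) := by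
  simp only [Matrix.mulVec, dotProduct, transition, bernoulliSum, Finset.sum_mul]
  rw [Finset.sum_comm]
  refine Finset.sum_congr rfl fun σ _ => ?_
  simp only [mul_assoc, ← Finset.mul_sum]
  congr 1
  simp only [Finset.sum_mul, mul_assoc]
  rw [Finset.sum_comm]
  refine Finset.sum_congr rfl fun F _ => ?_
  simp only [← Finset.mul_sum]
  simp

/-! ### The random field is stationary -/

/-- All edges at `v` are accepted. -/
def Accepted (G : SimpleGraph (Fin n)) (F : Finset (Fin n × Fin n)) (v : Fin n) : Prop :=
  ∀ e ∈ edges G, e.1 = v ∨ e.2 = v → e ∈ F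

omit [Fintype 𝒜] in
theorem update_of_accepted {F : Finset (Fin n × Fin n)} {v : Fin n} (h : Accepted G F v)
    (X : Fin n → 𝒜) (σ : Fin n → Option 𝒜) : update G X σ F v = (σ v).getD (X v) :=
  if_pos h

omit [Fintype 𝒜] in
theorem update_of_not_accepted {F : Finset (Fin n × Fin n)} {v : Fin n} (h : ¬ Accepted G F v)
    (X : Fin n → 𝒜) (σ : Fin n → Option 𝒜) : update G X σ F v = X v :=
  if_neg h

open Classical in
/-- Exchanges the labels of the accepted vertices with their proposals. -/
noncomputable def swap (G : SimpleGraph (Fin n)) (F : Finset (Fin n × Fin n))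
    (z : (Fin n → 𝒜) × (Fin n → Option 𝒜)) : (Fin n → 𝒜) × (Fin n → Option 𝒜) :=
  (update G z.1 z.2 F, fun v => if Accepted G F v then (z.2 v).map fun _ => z.1 v else z.2 v)

omit [Fintype 𝒜] in
theorem swap_involutive (F : Finset (Fin n × Fin n)) :
    Function.Involutive (swap (𝒜 := 𝒜) G F) := by
  rintro ⟨X, σ⟩
  refine Prod.ext (funext fun v => ?_) (funext fun v => ?_) <;> by_cases h : Accepted G F v
  · simp only [swap, update_of_accepted h, if_pos h]
    cases σ v <;> simp
  · simp only [swap, update_of_not_accepted h]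
  · simp only [swap, update_of_accepted h, if_pos h]
    cases σ v <;> simp
  · simp only [swap, if_neg h]

/-- At an active vertex the product is `p * b(X) * b(σ)` divided by a constant, which is symmetric
in label and proposal; an inactive vertex is left unchanged by the swap. -/
theorem b_mul_proposalProb_swap (p : ℝ) (F : Finset (Fin n × Fin n))
    (z : (Fin n → 𝒜) × (Fin n → Option 𝒜)) (v : Fin n) :
    (M.b v ((swap G F z).1 v) : ℝ) * M.proposalProb p v ((swap G F z).2 v) =
      M.b v (z.1 v) * M.proposalProb p v (z.2 v) := by
  obtain ⟨X, σ⟩ := z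
  by_cases h : Accepted G F v
  · simp only [swap, update_of_accepted h, if_pos h]
    cases σ v <;> simp [proposalProb]
    ring
  · simp only [swap, update_of_not_accepted h, if_neg h]

/-- If both ends are active, multiplying by `A(X_u, X_v)` completes the three acceptance factors to
the product over all four choices of label or proposal at each end, which no exchange at `u` or `v`
affects. This is why the acceptance rule has these three factors. -/
theorem A_mul_acceptProb_swap (F : Finset (Fin n × Fin n))
    (z : (Fin n → 𝒜) × (Fin n → Option 𝒜)) (e : Fin n × Fin n) :
    (M.A e.1 e.2 ((swap G F z).1 e.1) ((swap G F z).1 e.2) : ℝ) *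
        M.acceptProb (swap G F z).1 (swap G F z).2 e =
      M.A e.1 e.2 (z.1 e.1) (z.1 e.2) * M.acceptProb z.1 z.2 e := by
  obtain ⟨X, σ⟩ := z
  obtain ⟨u, v⟩ := e
  by_cases hu : Accepted G F u <;> by_cases hv : Accepted G F v <;>
    simp only [swap, acceptProb, update_of_accepted, update_of_not_accepted, hu, hv, if_pos,
      if_false, not_false_eq_true] <;>
    cases σ u <;> cases σ v <;> simp [ratio] <;> ring

/-- Neither end of a rejected edge is updated, so the swap changes nothing that this edge sees. -/
theorem acceptProb_swap_of_notMem {F : Finset (Fin n × Fin n)}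
    (z : (Fin n → 𝒜) × (Fin n → Option 𝒜)) {e : Fin n × Fin n} (he : e ∈ edges G)
    (heF : e ∉ F) :
    (M.A e.1 e.2 ((swap G F z).1 e.1) ((swap G F z).1 e.2) : ℝ) *
        (1 - M.acceptProb (swap G F z).1 (swap G F z).2 e) =
      M.A e.1 e.2 (z.1 e.1) (z.1 e.2) * (1 - M.acceptProb z.1 z.2 e) := by
  have h1 : ¬ Accepted G F e.1 := fun h => heF (h e he (Or.inl rfl))
  have h2 : ¬ Accepted G F e.2 := fun h => heF (h e he (Or.inr rfl))
  simp only [swap, acceptProb, update_of_not_accepted h1, update_of_not_accepted h2, if_neg h1,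
    if_neg h2]

/-- The joint weight of a labeling, proposals and a set of accepted edges. -/
noncomputable def jointWeight (p : ℝ) (F : Finset (Fin n × Fin n))
    (z : (Fin n → 𝒜) × (Fin n → Option 𝒜)) : ℝ :=
  M.weight z.1 * ((∏ v, M.proposalProb p v (z.2 v)) *
    ((∏ e ∈ F, M.acceptProb z.1 z.2 e) * ∏ e ∈ edges G \ F, (1 - M.acceptProb z.1 z.2 e)))

theorem jointWeight_eq (p : ℝ) {F : Finset (Fin n × Fin n)} (hF : F ⊆ edges G)
    (z : (Fin n → 𝒜) × (Fin n → Option 𝒜)) :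
    M.jointWeight p F z = (∏ v, (M.b v (z.1 v) : ℝ) * M.proposalProb p v (z.2 v)) *
      ((∏ e ∈ F, (M.A e.1 e.2 (z.1 e.1) (z.1 e.2) : ℝ) * M.acceptProb z.1 z.2 e) *
        ∏ e ∈ edges G \ F,
          (M.A e.1 e.2 (z.1 e.1) (z.1 e.2) : ℝ) * (1 - M.acceptProb z.1 z.2 e)) := by
  rw [jointWeight, weight, ← Finset.prod_sdiff hF]
  simp only [Finset.prod_mul_distrib]
  ring

theorem jointWeight_swap (p : ℝ) {F : Finset (Fin n × Fin n)} (hF : F ⊆ edges G)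
    (z : (Fin n → 𝒜) × (Fin n → Option 𝒜)) :
    M.jointWeight p F (swap G F z) = M.jointWeight p F z := by
  rw [M.jointWeight_eq p hF, M.jointWeight_eq p hF]
  refine congrArg₂ _ (Finset.prod_congr rfl fun v _ => M.b_mul_proposalProb_swap p F z v) ?_
  refine congrArg₂ _ (Finset.prod_congr rfl fun e _ => M.A_mul_acceptProb_swap F z e) ?_
  refine Finset.prod_congr rfl fun e he => ?_
  rw [Finset.mem_sdiff] at he
  exact M.acceptProb_swap_of_notMem z he.1 he.2

/-- A step of the chain is the first component of `swap`. Since `swap` is an involution that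
preserves the joint weight, labels before and after the step have the same law. -/
theorem sum_weight_mul_transition (p : ℝ) (hb : ∀ v, ∑ x, (M.b v x : ℝ) ≠ 0)
    (f : (Fin n → 𝒜) → ℝ) :
    ∑ X, M.weight X * (M.transition p).mulVec f X = ∑ X, M.weight X * f X := by
  classical
  have expand : ∀ g : Finset (Fin n × Fin n) → (Fin n → 𝒜) × (Fin n → Option 𝒜) → ℝ,
      ∑ X, M.weight X * ∑ σ : Fin n → Option 𝒜, (∏ v, M.proposalProb p v (σ v)) *
        bernoulliSum (edges G) (M.acceptProb X σ) (fun F => g F (X, σ)) =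
      ∑ F ∈ (edges G).powerset, ∑ z, M.jointWeight p F z * g F z := by
    intro g
    simp only [Fintype.sum_prod_type]
    rw [Finset.sum_comm]
    refine Finset.sum_congr rfl fun X _ => ?_
    rw [Finset.sum_comm, Finset.mul_sum]
    refine Finset.sum_congr rfl fun σ _ => ?_
    rw [bernoulliSum, Finset.mul_sum, Finset.mul_sum]
    refine Finset.sum_congr rfl fun F _ => ?_
    rw [jointWeight]
    ring
  have h1 := expand fun F z => f (swap G F z).1
  have h2 := expand fun _ z => f z.1
  simp only [bernoulliSum_const] at h2
  simp only [swap] at h1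
  simp only [M.transition_mulVec]
  rw [h1]
  have h3 : ∀ X : Fin n → 𝒜, ∑ σ : Fin n → Option 𝒜, (∏ v, M.proposalProb p v (σ v)) * f X =
      f X := fun X => by
    rw [← Finset.sum_mul, sum_prod_eq_one fun v => M.sum_proposalProb p (hb v), one_mul]
  simp only [h3] at h2
  rw [h2]
  refine Finset.sum_congr rfl fun F hF => ?_
  rw [Finset.mem_powerset] at hF
  rw [← Equiv.sum_comp (swap_involutive F).toPerm (fun z => M.jointWeight p F z * f z.1)]
  refine Finset.sum_congr rfl fun z _ => ?_
  simp only [Function.Involutive.coe_toPerm]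
  rw [M.jointWeight_swap p hF]
  rfl

end PairwiseMRF

end GibbsCC

namespace GibbsCC

/-! ### Contraction of the Metropolis-Hastings chain -/

/-- `f` changes by at most `K` when a single label is changed. -/
def LocallyLipschitz {V α : Type*} [DecidableEq V] (K : ℝ) (f : (V → α) → ℝ) : Prop :=
  ∀ X v a, |f X - f (Function.update X v a)| ≤ K

section Lipschitz

variable {V α : Type*} [DecidableEq V] {K : ℝ} {f : (V → α) → ℝ}

/-- Telescoping along a path that changes one label at a time. The path may leave the set of
admissible labelings, which is why `LocallyLipschitz` quantifies over all labelings. -/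
theorem LocallyLipschitz.abs_sub_le_card (hf : LocallyLipschitz K f) (s : Finset V) :
    ∀ X Y : V → α, (∀ v, X v ≠ Y v → v ∈ s) → |f X - f Y| ≤ K * s.card := by
  induction s using Finset.induction_on with
  | empty =>
    intro X Y h
    have : X = Y := funext fun v => by_contra fun hv => by simpa using h v hv
    simp [this]
  | insert v s hv ih =>
    intro X Y h
    have h1 := hf X v (Y v)
    have h2 := ih (Function.update X v (Y v)) Y fun u hu => by
      by_cases huv : u = v
      · subst huv; simp at hu
      · rw [Function.update_of_ne huv] at hu
        exact Finset.mem_of_mem_insert_of_ne (h u hu) huv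
    rw [Finset.card_insert_of_notMem hv]
    push_cast
    have := abs_sub_le (f X) (f (Function.update X v (Y v))) (f Y)
    linarith

end Lipschitz

namespace PairwiseMRF

variable {n : ℕ} {G : SimpleGraph (Fin n)} {𝒜 : Type} [Fintype 𝒜] (M : PairwiseMRF G 𝒜)

open Classical in
/-- If one transition contracts the Lipschitz constants of all functions by the factor `r`, then
the chain started anywhere is close to its stationary distribution. -/
theorem tvDist_le_of_contraction {p r : ℝ} {μ : (Fin n → 𝒜) → ℝ} (hμ : M.Represents μ)
    (hb : ∀ v, ∑ x, (M.b v x : ℝ) ≠ 0)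
    (hr : ∀ K f, 0 ≤ K → LocallyLipschitz K f → LocallyLipschitz (r * K) ((M.transition p).mulVec f))
    (hr0 : 0 ≤ r) (t : ℕ) (X : Fin n → 𝒜) : M.tvDist p t X μ ≤ n * r ^ t := by
  have hpow : ∀ (t : ℕ) (f : (Fin n → 𝒜) → ℝ), LocallyLipschitz 2 f →
      LocallyLipschitz (r ^ t * 2) ((M.transition p ^ t).mulVec f) := by
    intro t f hf
    induction t with
    | zero => simpa using hf
    | succ t ih =>
      rw [pow_succ' (M.transition p), ← Matrix.mulVec_mulVec, pow_succ', mul_assoc]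
      exact hr _ _ (by positivity) ih
  have hw : ∀ l, 0 ≤ M.weight l := fun l => by unfold weight; positivity
  have hμ0 : ∀ l, 0 ≤ μ l := fun l => by
    rw [hμ.2]
    exact div_nonneg (hw l) (Finset.sum_nonneg fun l _ => hw l)
  have hμ1 : ∑ l, μ l = 1 := by
    simp only [hμ.2]
    rw [← Finset.sum_div, div_self hμ.1]
  have hstat : ∀ f, ∑ l, μ l * (M.transition p).mulVec f l = ∑ l, μ l * f l := by
    intro f
    simp only [hμ.2, div_mul_eq_mul_div]
    rw [← Finset.sum_div, ← Finset.sum_div, M.sum_weight_mul_transition p hb]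
  have hstat' : ∀ (t : ℕ) f, ∑ l, μ l * (M.transition p ^ t).mulVec f l = ∑ l, μ l * f l := by
    intro t f
    induction t with
    | zero => simp
    | succ t ih =>
      rw [pow_succ' (M.transition p), ← Matrix.mulVec_mulVec, hstat, ih]
  -- The sign of the difference is the optimal test function for total variation. Its range in [-1,
  -- 1] gives the Lipschitz constant 2, which the factor 1/2 in `tvDist` cancels.
  set f : (Fin n → 𝒜) → ℝ := fun Y => SignType.sign ((M.transition p ^ t) X Y - μ Y) with hfdef
  have hf1 : ∀ Y, |f Y| ≤ 1 := by
    intro Y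
    simp only [hfdef]
    rcases lt_trichotomy ((M.transition p ^ t) X Y - μ Y) 0 with h | h | h
    · simp [sign_neg h]
    · simp [h]
    · simp [sign_pos h]
  have hf2 : LocallyLipschitz 2 f := fun Y v a => by
    have := abs_sub (f Y) (f (Function.update Y v a))
    linarith [hf1 Y, hf1 (Function.update Y v a)]
  -- By stationarity, `μ` may be replaced by the chain started from `μ`; this leaves an average of
  -- differences between two starting points.
  have key : ∑ Y, |(M.transition p ^ t) X Y - μ Y| =
      ∑ Z, μ Z * ((M.transition p ^ t).mulVec f X - (M.transition p ^ t).mulVec f Z) := by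
    simp only [mul_sub]
    rw [Finset.sum_sub_distrib, hstat', ← Finset.sum_mul, hμ1, one_mul, Matrix.mulVec, dotProduct,
      ← Finset.sum_sub_distrib]
    refine Finset.sum_congr rfl fun Y _ => ?_
    rw [← sub_mul, hfdef, self_mul_sign]
  have hbound : ∀ Z, (M.transition p ^ t).mulVec f X - (M.transition p ^ t).mulVec f Z ≤
      r ^ t * 2 * n := fun Z => by
    have := (hpow t f hf2).abs_sub_le_card Finset.univ X Z (by simp)
    rw [Finset.card_fin] at this
    exact (le_abs_self _).trans this
  have : ∑ Z, μ Z * ((M.transition p ^ t).mulVec f X - (M.transition p ^ t).mulVec f Z) ≤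
      ∑ Z, μ Z * (r ^ t * 2 * n) :=
    Finset.sum_le_sum fun Z _ => mul_le_mul_of_nonneg_left (hbound Z) (hμ0 Z)
  rw [← Finset.sum_mul, hμ1, one_mul] at this
  rw [tvDist, key]
  linarith

end PairwiseMRF

/-! ### Contraction for the neighbour labeling model -/

section Nbr

variable {n : ℕ} (G : SimpleGraph (Fin n)) (β : ℝ≥0∞)

theorem expNeg_le_one : expNeg β ≤ 1 := by
  unfold expNeg
  split_ifs
  · exact zero_le_one
  · rw [Real.toNNReal_le_one]
    exact Real.exp_le_one_iff.mpr (by simp)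

theorem expNeg_zero : expNeg 0 = 1 := by simp [expNeg]

theorem expNeg_top : expNeg ⊤ = 0 := by simp [expNeg]

theorem nbrMRF_sup (hn : 1 ≤ n) (u v : Fin n) :
    (Finset.univ.sup fun z : NbrLabel n × NbrLabel n => (nbrMRF G β).A u v z.1 z.2 : ℝ≥0) = 1 := by
  refine le_antisymm (Finset.sup_le fun z _ => ?_) ?_
  · simp only [nbrMRF]
    split_ifs
    · exact expNeg_le_one β
    · exact le_rfl
  · let k : Fin (3 * n) := ⟨0, by omega⟩
    refine le_trans ?_ (Finset.le_sup (Finset.mem_univ (Sum.inr k, Sum.inr k)))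
    simp [nbrMRF]

theorem nbrMRF_ratio_eq_one {x y : Option (NbrLabel n)} (hn : 1 ≤ n) (u v : Fin n)
    (h : ∀ w, x = some (Sum.inl w) → y ≠ some (Sum.inl w)) :
    (nbrMRF G β).ratio u v x y = 1 := by
  rcases x with _ | x <;> rcases y with _ | y <;> simp only [PairwiseMRF.ratio]
  rw [nbrMRF_sup G β hn]
  have : ¬ ∃ w, x = Sum.inl w ∧ y = Sum.inl w := by
    rintro ⟨w, rfl, rfl⟩
    exact h w rfl rfl
  simp [nbrMRF, this]

open Classical in
theorem card_admissible (v : Fin n) :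
    (Finset.univ.filter fun x : NbrLabel n => ∀ w, x = Sum.inl w → G.Adj v w).card =
      3 * n + (G.neighborSet v).ncard := by
  rw [Set.ncard_eq_toFinset_card', Finset.card_filter, Fintype.sum_sum_type, add_comm]
  congr 1
  · simp
  · rw [← Finset.card_filter]
    congr 1
    ext w
    simp

theorem sum_nbrMRF_b (v : Fin n) :
    ∑ x, ((nbrMRF G β).b v x : ℝ) = 3 * n + (G.neighborSet v).ncard := by
  classical
  have := card_admissible G v
  rw [Finset.card_filter] at this
  have h2 := congrArg (Nat.cast : ℕ → ℝ) this
  push_cast at h2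
  rw [← h2]
  refine Finset.sum_congr rfl fun x _ => ?_
  simp only [nbrMRF]
  split_ifs <;> simp

theorem ncard_neighborSet_le (v : Fin n) : (G.neighborSet v).ncard ≤ n := by
  simpa using Set.ncard_le_card (G.neighborSet v)

theorem sum_nbrMRF_b_pos (hn : 1 ≤ n) (v : Fin n) : 0 < ∑ x, ((nbrMRF G β).b v x : ℝ) := by
  rw [sum_nbrMRF_b]
  have : (1 : ℝ) ≤ n := by exact_mod_cast hn
  positivity

/-- The labels in [3n] are admissible everywhere, so each proposal is uniform over at least `3 * n`
labels. -/
theorem nbrMRF_proposalProb_le {p : ℝ} (hp : 0 ≤ p) (hn : 1 ≤ n) (v : Fin n) (a : NbrLabel n) :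
    (nbrMRF G β).proposalProb p v (some a) ≤ p / (3 * n) := by
  have hn' : (1 : ℝ) ≤ n := by exact_mod_cast hn
  simp only [PairwiseMRF.proposalProb]
  rw [sum_nbrMRF_b, div_eq_mul_one_div p]
  refine mul_le_mul_of_nonneg_left ?_ hp
  have hb : ((nbrMRF G β).b v a : ℝ) ≤ 1 := by
    simp only [nbrMRF]
    split_ifs <;> simp
  refine div_le_div₀ zero_le_one hb (by positivity) ?_
  linarith [Nat.cast_nonneg (α := ℝ) (G.neighborSet v).ncard]

/-- The indicator of a proposal in `[3n]`. -/
def isFresh {n : ℕ} : Option (NbrLabel n) → ℝ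
  | some (Sum.inr _) => 1
  | _ => 0

open Classical in
/-- The indicator of a proposal equal to `x` or `y`. -/
noncomputable def hits {n : ℕ} (x y : NbrLabel n) (a : Option (NbrLabel n)) : ℝ :=
  if a = some x ∨ a = some y then 1 else 0

theorem sum_proposalProb_mul_hits {p : ℝ} (hp : 0 ≤ p) (hp1 : p ≤ 1) (hn : 1 ≤ n) (v : Fin n)
    (x y : NbrLabel n) :
    ∑ a, (nbrMRF G β).proposalProb p v a * hits x y a ≤ 2 * p / (3 * n) := by
  classical
  have h : ∀ a, (nbrMRF G β).proposalProb p v a * hits x y a ≤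
      (if a = some x then (nbrMRF G β).proposalProb p v (some x) else 0) +
        (if a = some y then (nbrMRF G β).proposalProb p v (some y) else 0) := by
    intro a
    have := (nbrMRF G β).proposalProb_nonneg hp hp1 v
    unfold hits
    by_cases hx : a = some x
    · have h0 : 0 ≤ if a = some y then (nbrMRF G β).proposalProb p v (some y) else 0 := by
        split_ifs <;> simp [this]
      rw [if_pos (Or.inl hx), if_pos hx, mul_one, hx] at *
      linarith
    · by_cases hy : a = some y
      · rw [if_pos (Or.inr hy), if_neg hx, if_pos hy, mul_one, zero_add, hy]
      · simp [hx, hy]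
  refine (Finset.sum_le_sum fun a _ => h a).trans ?_
  rw [Finset.sum_add_distrib, Finset.sum_ite_eq', Finset.sum_ite_eq']
  simp only [Finset.mem_univ, if_true]
  have h1 := nbrMRF_proposalProb_le G β hp hn v x
  have h2 := nbrMRF_proposalProb_le G β hp hn v y
  rw [mul_div_assoc]
  linarith

theorem sum_proposalProb_mul_isFresh (p : ℝ) (v : Fin n) :
    ∑ a, (nbrMRF G β).proposalProb p v a * isFresh a =
      p * (3 * n / (3 * n + (G.neighborSet v).ncard)) := by
  rw [Fintype.sum_option, Fintype.sum_sum_type]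
  simp only [PairwiseMRF.proposalProb, isFresh, sum_nbrMRF_b]
  simp [nbrMRF]
  ring

/-! ### Coupling two chains whose labelings differ only at `v` -/

variable {G β} {X Y : Fin n → NbrLabel n} {v : Fin n}

/-- The proposal of `u` is one of the two labels of `v`. -/
def Clash (X Y : Fin n → NbrLabel n) (v : Fin n) (σ : Fin n → Option (NbrLabel n))
    (u : Fin n) : Prop :=
  σ u = some (X v) ∨ σ u = some (Y v)

/-- The label of `v` enters only the factor that compares it with the proposal at the other end, and
without a clash this factor is 1 for both labelings. -/
theorem acceptProb_eq_of_not_clash (hn : 1 ≤ n) (hXY : ∀ u, u ≠ v → X u = Y u)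
    {σ : Fin n → Option (NbrLabel n)} {e : Fin n × Fin n} (he : e ∈ edges G)
    (h1 : e.1 = v → ¬ Clash X Y v σ e.2) (h2 : e.2 = v → ¬ Clash X Y v σ e.1) :
    (nbrMRF G β).acceptProb X σ e = (nbrMRF G β).acceptProb Y σ e := by
  obtain ⟨a, b⟩ := e
  have hab : a ≠ b := by
    simp only [edges, Finset.mem_filter] at he
    exact he.2.1.ne
  simp only [PairwiseMRF.acceptProb] at *
  congr 2
  · by_cases ha : a = v
    · subst ha
      have := h1 rfl
      rw [nbrMRF_ratio_eq_one G β hn, nbrMRF_ratio_eq_one G β hn]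
      · rintro w hw hw'
        exact this (Or.inr (hw'.trans hw.symm))
      · rintro w hw hw'
        exact this (Or.inl (hw'.trans hw.symm))
    · rw [hXY a ha]
  · by_cases hb : b = v
    · subst hb
      have := h2 rfl
      rw [nbrMRF_ratio_eq_one G β hn, nbrMRF_ratio_eq_one G β hn]
      · rintro w hw hw'
        exact this (Or.inr (hw.trans hw'.symm))
      · rintro w hw hw'
        exact this (Or.inl (hw.trans hw'.symm))
    · rw [hXY b hb]

/-- The two factors containing the proposal of `v` are 1 because labels in [3n] conflict with
nothing; the third is 1 because the other end does not propose `X v`. -/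
theorem acceptProb_eq_one_of_fresh (hn : 1 ≤ n) {σ : Fin n → Option (NbrLabel n)}
    (hc : ∀ u, G.Adj v u → ¬ Clash X Y v σ u) {k : Fin (3 * n)} (hk : σ v = some (Sum.inr k))
    {e : Fin n × Fin n} (he : e ∈ edges G) (hev : e.1 = v ∨ e.2 = v) :
    (nbrMRF G β).acceptProb X σ e = 1 := by
  obtain ⟨a, b⟩ := e
  simp only [edges, Finset.mem_filter] at he
  have hab := he.2.2
  simp only [PairwiseMRF.acceptProb] at *
  rcases hev with rfl | rfl
  · have := hc b hab
    rw [nbrMRF_ratio_eq_one G β hn, nbrMRF_ratio_eq_one G β hn, nbrMRF_ratio_eq_one G β hn]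
    · simp
    · simp [hk]
    · simp [hk]
    · exact fun w hw hw' => this (Or.inl (hw'.trans hw.symm))
  · have := hc a hab.symm
    rw [nbrMRF_ratio_eq_one G β hn, nbrMRF_ratio_eq_one G β hn, nbrMRF_ratio_eq_one G β hn]
    · simp
    · simp [hk]
    · exact fun w hw hw' => this (Or.inl (hw.trans hw'.symm))
    · simp [hk]

-- The edge sets may differ only at edges from `v` to a clashing neighbour. Any other vertex `u ≠ v`
-- has no such edge, so it has the same label, proposal and acceptance in both chains.
open Classical in
theorem eq_or_clash_of_update_ne (hXY : ∀ u, u ≠ v → X u = Y u)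
    {σ : Fin n → Option (NbrLabel n)} {F F' : Finset (Fin n × Fin n)}
    (hF : ∀ e, ¬ ((e.1 = v ∧ Clash X Y v σ e.2) ∨ (e.2 = v ∧ Clash X Y v σ e.1)) →
      (e ∈ F ↔ e ∈ F')) {u : Fin n}
    (hu : PairwiseMRF.update G X σ F u ≠ PairwiseMRF.update G Y σ F' u) :
    u = v ∨ (G.Adj v u ∧ Clash X Y v σ u) := by
  by_contra hne
  push Not at hne
  obtain ⟨huv, hcl⟩ := hne
  apply hu
  have hmem : ∀ e ∈ edges G, e.1 = u ∨ e.2 = u → (e ∈ F ↔ e ∈ F') := by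
    rintro ⟨a, b⟩ he heu
    simp only [edges, Finset.mem_filter] at he
    refine hF _ ?_
    rintro (⟨h1, h2⟩ | ⟨h1, h2⟩) <;> simp only at h1 h2 heu
    · rcases heu with rfl | rfl
      · exact huv h1
      · exact hcl (h1 ▸ he.2.2) h2
    · rcases heu with rfl | rfl
      · exact hcl (h1 ▸ he.2.2.symm) h2
      · exact huv h1
  have hacc : PairwiseMRF.Accepted G F u ↔ PairwiseMRF.Accepted G F' u :=
    forall_congr' fun e => forall_congr' fun he => forall_congr' fun heu => hmem e he heu
  by_cases h : PairwiseMRF.Accepted G F u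
  · rw [PairwiseMRF.update_of_accepted h, PairwiseMRF.update_of_accepted (hacc.mp h), hXY u huv]
  · rw [PairwiseMRF.update_of_not_accepted h, PairwiseMRF.update_of_not_accepted (mt hacc.mpr h),
      hXY u huv]

open Classical in
/-- Given the proposals, the two chains can be coupled such that their distance is at most the
number of clashes plus one, and zero if there is no clash and `v` proposes a label in `[3n]`. -/
theorem abs_sub_le_of_proposals (hn : 1 ≤ n) (hXY : ∀ u, u ≠ v → X u = Y u) {K : ℝ} (hK : 0 ≤ K)
    {f : (Fin n → NbrLabel n) → ℝ} (hf : LocallyLipschitz K f)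
    (σ : Fin n → Option (NbrLabel n)) :
    |bernoulliSum (edges G) ((nbrMRF G β).acceptProb X σ)
          (fun F => f (PairwiseMRF.update G X σ F)) -
        bernoulliSum (edges G) ((nbrMRF G β).acceptProb Y σ)
          (fun F => f (PairwiseMRF.update G Y σ F))| ≤
      K * (1 - isFresh (σ v) + (∑ u ∈ G.neighborFinset v, hits (X v) (Y v) (σ u)) +
        ∑ u ∈ G.neighborFinset v, isFresh (σ v) * hits (X v) (Y v) (σ u)) := by
  set N := (G.neighborFinset v).filter fun u => Clash X Y v σ u with hN
  have hsum : ∑ u ∈ G.neighborFinset v, hits (X v) (Y v) (σ u) = N.card := by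
    simp only [hits]
    rw [Finset.sum_boole, hN]
    congr 2
    ext u
    rw [Finset.mem_filter, Finset.mem_filter, Clash]
  have hmain : |bernoulliSum (edges G) ((nbrMRF G β).acceptProb X σ)
          (fun F => f (PairwiseMRF.update G X σ F)) -
        bernoulliSum (edges G) ((nbrMRF G β).acceptProb Y σ)
          (fun F => f (PairwiseMRF.update G Y σ F))| ≤ K * (1 + N.card) := by
    refine abs_bernoulliSum_sub_le (edges G) (Finset.univ.filter fun e =>
      (e.1 = v ∧ Clash X Y v σ e.2) ∨ (e.2 = v ∧ Clash X Y v σ e.1)) _ _ _ _ _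
      (PairwiseMRF.acceptProb_mem _ _ _) (PairwiseMRF.acceptProb_mem _ _ _) ?_ ?_
    · intro e he heB
      simp only [Finset.mem_filter, Finset.mem_univ, true_and] at heB
      push Not at heB
      exact acceptProb_eq_of_not_clash hn hXY he heB.1 heB.2
    · intro F F' hFF
      have h := hf.abs_sub_le_card (insert v N) (PairwiseMRF.update G X σ F)
        (PairwiseMRF.update G Y σ F') fun u hu => by
          have := eq_or_clash_of_update_ne hXY (fun e he => hFF e (by simpa using he)) hu
          simpa [hN] using this
      refine h.trans (mul_le_mul_of_nonneg_left ?_ hK)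
      have := Finset.card_insert_le v N
      rw [add_comm]
      exact_mod_cast this
  rw [← Finset.mul_sum, hsum]
  rcases hσ : σ v with _ | (w | k)
  · simpa [isFresh] using hmain
  · simpa [isFresh] using hmain
  simp only [isFresh]
  -- Without a clash the edge probabilities coincide and those at `v` equal 1, so `v` surely takes
  -- its proposal in both chains and they meet.
  rcases N.card.eq_zero_or_pos with h0 | hpos
  · have hc : ∀ u, G.Adj v u → ¬ Clash X Y v σ u := by
      intro u hu hcl
      have : u ∈ N := by simp [hN, hu, hcl]
      rw [Finset.card_eq_zero.mp h0] at this
      simp at this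
    have : bernoulliSum (edges G) ((nbrMRF G β).acceptProb X σ)
          (fun F => f (PairwiseMRF.update G X σ F)) =
        bernoulliSum (edges G) ((nbrMRF G β).acceptProb Y σ)
          (fun F => f (PairwiseMRF.update G Y σ F)) := by
      refine bernoulliSum_congr_of_eq_one ?_ ?_
      · rintro ⟨a, b⟩ he
        have hab := he
        simp only [edges, Finset.mem_filter] at hab
        refine acceptProb_eq_of_not_clash hn hXY he ?_ ?_
        · rintro rfl
          exact hc b hab.2.2
        · rintro rfl
          exact hc a hab.2.2.symm
      · intro F hF
        have hacc : PairwiseMRF.Accepted G F v := fun e he hev =>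
          hF e he (acceptProb_eq_one_of_fresh hn hc hσ he hev)
        congr 1
        funext u
        by_contra hne
        rcases eq_or_clash_of_update_ne hXY (fun e _ => Iff.rfl) hne with rfl | ⟨h1, h2⟩
        · apply hne
          rw [PairwiseMRF.update_of_accepted hacc, PairwiseMRF.update_of_accepted hacc, hσ]
          rfl
        · exact hc u h1 h2
    rw [this, sub_self, abs_zero]
    positivity
  · refine hmain.trans (mul_le_mul_of_nonneg_left ?_ hK)
    -- With `isFresh` equal to 1 the bound reads `2 * N.card`, which dominates `1 + N.card`. The
    -- products of indicators are used because their expectations factor over distinct vertices.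
    have : (1 : ℝ) ≤ N.card := by exact_mod_cast hpos
    linarith

theorem nbrMRF_contraction (G : SimpleGraph (Fin n)) (β : ℝ≥0∞) (hn : 1 ≤ n) {K : ℝ} (hK : 0 ≤ K)
    {f : (Fin n → NbrLabel n) → ℝ} (hf : LocallyLipschitz K f) :
    LocallyLipschitz ((1 - 1 / 384) * K) (((nbrMRF G β).transition (1 / 16)).mulVec f) := by
  classical
  intro X v a
  set Y := Function.update X v a with hY
  have hXY : ∀ u, u ≠ v → X u = Y u := fun u hu => (Function.update_of_ne hu _ _).symm
  have hn' : (1 : ℝ) ≤ n := by exact_mod_cast hn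
  have hprop : ∀ σ : Fin n → Option (NbrLabel n),
      0 ≤ ∏ u, (nbrMRF G β).proposalProb (1 / 16) u (σ u) := fun σ =>
    Finset.prod_nonneg fun u _ => PairwiseMRF.proposalProb_nonneg _ (by norm_num) (by norm_num) _ _
  have hone : ∀ u, ∑ a, (nbrMRF G β).proposalProb (1 / 16) u a = 1 := fun u =>
    PairwiseMRF.sum_proposalProb _ _ (sum_nbrMRF_b_pos G β hn u).ne'
  rw [PairwiseMRF.transition_mulVec, PairwiseMRF.transition_mulVec, ← Finset.sum_sub_distrib]
  simp only [← mul_sub]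
  refine (Finset.abs_sum_le_sum_abs _ _).trans ?_
  simp only [abs_mul, abs_of_nonneg (hprop _)]
  refine (Finset.sum_le_sum fun σ _ => mul_le_mul_of_nonneg_left
    (abs_sub_le_of_proposals hn hXY hK hf σ) (hprop σ)).trans ?_
  have hg := sum_proposalProb_mul_isFresh G β (1 / 16) v
  set g := ∑ a, (nbrMRF G β).proposalProb (1 / 16) v a * isFresh a
  have hdeg : ((G.neighborSet v).ncard : ℝ) ≤ n := by exact_mod_cast ncard_neighborSet_le G v
  have hfrac : 3 / 4 ≤ (3 * (n : ℝ) / (3 * n + (G.neighborSet v).ncard)) := by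
    rw [div_le_div_iff₀ (by norm_num) (by positivity)]
    linarith
  have hfrac1 : (3 * (n : ℝ) / (3 * n + (G.neighborSet v).ncard)) ≤ 1 := by
    refine div_le_one_of_le₀ ?_ (by positivity)
    linarith [Nat.cast_nonneg (α := ℝ) (G.neighborSet v).ncard]
  set B := ∑ u ∈ G.neighborFinset v,
    ∑ a, (nbrMRF G β).proposalProb (1 / 16) u a * hits (X v) (Y v) a with hB
  have hBle : B ≤ 1 / 24 := by
    have h1 : B ≤ ∑ _u ∈ G.neighborFinset v, 2 * (1 / 16) / (3 * (n : ℝ)) :=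
      Finset.sum_le_sum fun u _ =>
        sum_proposalProb_mul_hits G β (by norm_num) (by norm_num) hn u _ _
    rw [Finset.sum_const, nsmul_eq_mul] at h1
    have hcard : ((G.neighborFinset v).card : ℝ) ≤ n := by
      exact_mod_cast (Finset.card_le_univ _).trans (by simp)
    have h2 : ((G.neighborFinset v).card : ℝ) * (2 * (1 / 16) / (3 * (n : ℝ))) ≤
        n * (2 * (1 / 16) / (3 * (n : ℝ))) := mul_le_mul_of_nonneg_right hcard (by positivity)
    have h3 : (n : ℝ) * (2 * (1 / 16) / (3 * (n : ℝ))) = 1 / 24 := by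
      field_simp
      norm_num
    linarith
  have hB0 : 0 ≤ B := Finset.sum_nonneg fun u _ => Finset.sum_nonneg fun a _ =>
    mul_nonneg (PairwiseMRF.proposalProb_nonneg _ (by norm_num) (by norm_num) _ _)
      (by unfold hits; split_ifs <;> simp)
  have htotal : ∑ σ : Fin n → Option (NbrLabel n),
      (∏ u, (nbrMRF G β).proposalProb (1 / 16) u (σ u)) *
        (K * (1 - isFresh (σ v) + (∑ u ∈ G.neighborFinset v, hits (X v) (Y v) (σ u)) +
          ∑ u ∈ G.neighborFinset v, isFresh (σ v) * hits (X v) (Y v) (σ u))) =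
      K * (1 - g + B + g * B) := by
    simp only [mul_left_comm _ K, ← Finset.mul_sum]
    congr 1
    simp only [mul_add, mul_sub, mul_one, Finset.sum_add_distrib, Finset.sum_sub_distrib]
    rw [sum_prod_eq_one hone, sum_prod_mul_apply hone v]
    congr 1
    · congr 1
      simp only [Finset.mul_sum]
      rw [Finset.sum_comm]
      exact Finset.sum_congr rfl fun u _ => sum_prod_mul_apply hone u _
    · rw [hB, Finset.mul_sum]
      simp only [Finset.mul_sum]
      rw [Finset.sum_comm]
      refine Finset.sum_congr rfl fun u hu => ?_
      have huv : v ≠ u := ((G.mem_neighborFinset v u).mp hu).ne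
      have := sum_prod_mul_apply_mul_apply hone huv isFresh (hits (X v) (Y v))
      rw [this, Finset.mul_sum]
  rw [htotal, mul_comm K]
  refine mul_le_mul_of_nonneg_right ?_ hK
  -- Here 3/64 ≤ g ≤ 1/16 and B ≤ 1/24, so g - B ≥ 1/192 and g * B ≤ 1/384; the net gain is at least
  -- 1/384.
  nlinarith

end Nbr

theorem fastMixing_nbrModel : FastMixing nbrModel := by
  refine ⟨1 / 16, 384, by norm_num, by norm_num, by norm_num, ?_⟩
  rintro n hn _ ⟨G, rfl⟩ β hβ X - δ hδ - t ht
  have hn' : (1 : ℝ) ≤ n := by exact_mod_cast hn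
  refine (PairwiseMRF.tvDist_le_of_contraction _ ((nbrLocalGibbs G).mrf_represents β hβ)
    (fun v => (sum_nbrMRF_b_pos G β hn v).ne')
    (fun K f hK hf => nbrMRF_contraction G β hn hK hf) (by norm_num) t X).trans ?_
  have h1 : (1 - 1 / 384 : ℝ) ^ t ≤ Real.exp (-(t / 384)) := by
    have : (1 - 1 / 384 : ℝ) ≤ Real.exp (-(1 / 384)) := by
      have := Real.add_one_le_exp (-(1 / 384) : ℝ)
      linarith
    refine (pow_le_pow_left₀ (by norm_num) this t).trans ?_
    rw [← Real.exp_nat_mul]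
    exact le_of_eq (congrArg _ (by ring))
  have h2 : Real.exp (-(t / 384)) ≤ δ / n := by
    rw [← Real.le_log_iff_exp_le (by positivity), ← inv_div (n : ℝ) δ, Real.log_inv]
    linarith
  calc (n : ℝ) * (1 - 1 / 384) ^ t ≤ n * (δ / n) :=
        mul_le_mul_of_nonneg_left (h1.trans h2) (by positivity)
    _ = δ := by field_simp

end GibbsCC

namespace GibbsCC

/-! ### The partition function and triangles -/

section Partition

variable {n : ℕ} (G : SimpleGraph (Fin n))

open Classical in
/-- The labels that `v` may have. -/
noncomputable def admissible (v : Fin n) : Finset (NbrLabel n) :=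
  Finset.univ.filter fun x => ∀ w, x = Sum.inl w → G.Adj v w

theorem nbrGibbs_S : (nbrGibbs G).S = Fintype.piFinset (admissible G) := by
  classical
  ext σ
  simp [nbrGibbs, admissible, Fintype.mem_piFinset]

theorem nbrGibbs_Z_zero :
    (nbrGibbs G).Z 0 = ∏ v, (3 * (n : ℝ) + (G.neighborSet v).ncard) := by
  classical
  unfold GibbsDistribution.Z
  simp only [expNeg_zero, NNReal.coe_one, one_pow, Finset.sum_const, nsmul_eq_mul, mul_one]
  rw [nbrGibbs_S, Fintype.card_piFinset, Nat.cast_prod]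
  refine Finset.prod_congr rfl fun v _ => ?_
  rw [admissible, card_admissible]
  push_cast
  rfl

theorem nbrGibbs_Z_zero_pos : 0 < (nbrGibbs G).Z 0 := by
  rw [nbrGibbs_Z_zero]
  refine Finset.prod_pos fun v _ => ?_
  have : (1 : ℝ) ≤ n := by exact_mod_cast Fin.pos v
  positivity

variable {G}

theorem nbrGibbs_H_eq_zero (hG : G.CliqueFree 3) {σ : Fin n → NbrLabel n}
    (hσ : σ ∈ (nbrGibbs G).S) : (nbrGibbs G).H σ = 0 := by
  classical
  simp only [nbrGibbs, Finset.mem_filter, Finset.mem_univ, true_and] at hσ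
  simp only [nbrGibbs]
  rw [Finset.card_eq_zero, Finset.filter_eq_empty_iff]
  rintro ⟨a, b⟩ he ⟨w, ha, hb⟩
  simp only [edges, Finset.mem_filter] at he
  exact hG {a, b, w} (SimpleGraph.is3Clique_triple_iff.mpr ⟨he.2.2, hσ a w ha, hσ b w hb⟩)

theorem nbrGibbs_Z_top_of_cliqueFree (hG : G.CliqueFree 3) :
    (nbrGibbs G).Z ⊤ = (nbrGibbs G).Z 0 := by
  unfold GibbsDistribution.Z
  exact Finset.sum_congr rfl fun σ hσ => by simp [nbrGibbs_H_eq_zero hG hσ]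

theorem nbrGibbs_Z_top_le_of_not_cliqueFree (hG : ¬ G.CliqueFree 3) :
    (nbrGibbs G).Z ⊤ ≤ (1 - 1 / (16 * (n : ℝ) ^ 2)) * (nbrGibbs G).Z 0 := by
  classical
  obtain ⟨a, b, c, hab, hac, hbc⟩ : ∃ a b c, G.Adj a b ∧ G.Adj a c ∧ G.Adj b c := by
    simp only [SimpleGraph.CliqueFree, not_forall, not_not] at hG
    obtain ⟨s, hs⟩ := hG
    obtain ⟨a, b, c, h1, h2, h3, -⟩ := SimpleGraph.is3Clique_iff.mp hs
    exact ⟨a, b, c, h1, h2, h3⟩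
  -- `edges` lists every edge with its smaller end first.
  wlog hlt : a < b generalizing a b
  · exact this b a hab.symm hbc hac (lt_of_le_of_ne (not_lt.mp hlt) hab.ne')
  have hn : (1 : ℝ) ≤ n := by exact_mod_cast Fin.pos a
  -- The labelings in which `a` and `b` both carry the label `c`. They count 1 each in Z(0) and 0 in
  -- Z(∞).
  set T : Fin n → Finset (NbrLabel n) := fun v =>
    if v = a ∨ v = b then {Sum.inl c} else admissible G v with hT
  have hTS : Fintype.piFinset T ⊆ (nbrGibbs G).S := by
    rw [nbrGibbs_S]
    refine Fintype.piFinset_subset _ _ fun v x hx => ?_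
    simp only [hT] at hx
    split_ifs at hx with h
    · rw [Finset.mem_singleton] at hx
      subst hx
      rcases h with rfl | rfl <;> simp [admissible, hac, hbc]
    · exact hx
  have hTH : ∀ σ ∈ Fintype.piFinset T, (nbrGibbs G).H σ ≠ 0 := by
    intro σ hσ
    rw [Fintype.mem_piFinset] at hσ
    have ha := hσ a
    have hb := hσ b
    simp only [hT, true_or, or_true, if_true, Finset.mem_singleton] at ha hb
    simp only [nbrGibbs]
    rw [Finset.card_ne_zero]
    exact ⟨(a, b), Finset.mem_filter.mpr ⟨by simp [edges, hlt, hab], c, ha, hb⟩⟩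
  have h1 : (nbrGibbs G).Z ⊤ + (Fintype.piFinset T).card ≤ (nbrGibbs G).Z 0 := by
    have h2 : ((Fintype.piFinset T).card : ℝ) =
        ∑ σ ∈ (nbrGibbs G).S, if σ ∈ Fintype.piFinset T then (1 : ℝ) else 0 := by
      rw [Finset.sum_boole, Finset.filter_mem_eq_inter, Finset.inter_eq_right.mpr hTS]
    unfold GibbsDistribution.Z
    rw [h2, ← Finset.sum_add_distrib]
    refine Finset.sum_le_sum fun σ _ => ?_
    simp only [expNeg_zero, expNeg_top, NNReal.coe_one, NNReal.coe_zero, one_pow]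
    split_ifs with h
    · simp [hTH σ h]
    · rw [add_zero]
      exact pow_le_one₀ le_rfl zero_le_one
  -- The factors of the two products agree except at `a` and `b`, where `3 * n + deg ≤ 4 * n` is
  -- replaced by 1.
  have h3 : (nbrGibbs G).Z 0 ≤ 16 * (n : ℝ) ^ 2 * (Fintype.piFinset T).card := by
    rw [nbrGibbs_Z_zero, Fintype.card_piFinset, Nat.cast_prod]
    have h4 : ∏ v, ((if v = a then 4 * (n : ℝ) else 1) * (if v = b then 4 * (n : ℝ) else 1)) =
        16 * (n : ℝ) ^ 2 := by
      rw [Finset.prod_mul_distrib, Finset.prod_ite_eq', Finset.prod_ite_eq']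
      simp only [Finset.mem_univ, if_true]
      ring
    rw [← h4, ← Finset.prod_mul_distrib]
    refine Finset.prod_le_prod (fun v _ => by positivity) fun v _ => ?_
    have hdeg : ((G.neighborSet v).ncard : ℝ) ≤ n := by exact_mod_cast ncard_neighborSet_le G v
    by_cases ha : v = a
    · subst ha
      simp [hT, hab.ne]
      linarith
    · by_cases hb : v = b
      · subst hb
        simp [hT, hab.ne']
        linarith
      · have : ((T v).card : ℝ) = 3 * n + (G.neighborSet v).ncard := by
          simp only [hT, ha, hb, or_self, if_false]
          rw [admissible, card_admissible]
          push_cast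
          rfl
        simp [ha, hb, this]
  have h5 : 1 / (16 * (n : ℝ) ^ 2) * (nbrGibbs G).Z 0 ≤ (Fintype.piFinset T).card := by
    rw [one_div, inv_mul_le_iff₀ (by positivity)]
    exact h3
  linarith

/-- The threshold works because (1 + ε)(1 - 2ε) = 1 - ε - 2ε² lies strictly below 1 - ε. -/
theorem lt_iff_not_cliqueFree {ε z : ℝ} (hε : 0 < ε) (hε' : ε ≤ 1 / (32 * (n : ℝ) ^ 2))
    (h1 : (1 - ε) * (nbrGibbs G).Z ⊤ ≤ z) (h2 : z ≤ (1 + ε) * (nbrGibbs G).Z ⊤) :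
    z < (1 - ε) * (nbrGibbs G).Z 0 ↔ ¬ G.CliqueFree 3 := by
  constructor
  · intro h hG
    rw [nbrGibbs_Z_top_of_cliqueFree hG] at h1
    linarith
  · intro hG
    have h3 := nbrGibbs_Z_top_le_of_not_cliqueFree hG
    have h4 := nbrGibbs_Z_zero_pos G
    have h5 : 1 / (16 * (n : ℝ) ^ 2) = 2 * (1 / (32 * (n : ℝ) ^ 2)) := by
      rw [mul_one_div, div_eq_div_iff_comm]
      ring_nf
    rw [h5] at h3
    have h6 : (nbrGibbs G).Z ⊤ ≤ (1 - 2 * ε) * (nbrGibbs G).Z 0 := by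
      refine h3.trans (mul_le_mul_of_nonneg_right ?_ h4.le)
      linarith
    calc z ≤ (1 + ε) * (nbrGibbs G).Z ⊤ := h2
      _ ≤ (1 + ε) * ((1 - 2 * ε) * (nbrGibbs G).Z 0) :=
        mul_le_mul_of_nonneg_left h6 (by linarith)
      _ = (1 - ε) * (nbrGibbs G).Z 0 - 2 * ε ^ 2 * (nbrGibbs G).Z 0 := by ring
      _ < (1 - ε) * (nbrGibbs G).Z 0 := by
        have : 0 < 2 * ε ^ 2 * (nbrGibbs G).Z 0 := by positivity
        linarith

end Partition

/-! ### The model is local -/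

theorem polyBounded_nbrModel : PolyBounded nbrModel := by
  refine ⟨4, fun n => ?_⟩
  have h1 : n ≤ n ^ 4 := Nat.le_self_pow (by norm_num) n
  constructor
  · simp only [Fintype.card_sum, Fintype.card_fin]
    omega
  · rintro _ ⟨G, rfl⟩
    show n ^ 2 ≤ _
    have : n ^ 2 ≤ n ^ 4 + 1 := by
      rcases n.eq_zero_or_pos with rfl | h
      · simp
      · exact (Nat.pow_le_pow_right h (by norm_num)).trans (Nat.le_succ _)
    omega

/-- The algorithm without communication in which every machine outputs `a`. -/
noncomputable def constAlgorithm (n c : ℕ) (In : Type) {Out : Type} [MeasurableSpace Out] (a : Out) :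
    Algorithm n c In Out where
  Seed := Unit
  seedLaw := Measure.dirac ()
  rounds := 0
  send := fun _ _ _ _ _ _ => false
  out := fun _ _ _ _ => a
  measurable_send := fun _ _ _ _ => measurable_const
  measurable_out := fun _ _ _ => measurable_const

theorem constructible_nbrModel : Constructible nbrModel := by
  -- No communication is needed: the constant labeling by an element of [3n] is admissible for every
  -- graph.
  refine ⟨0, 0, fun n hn => ?_⟩
  let k : Fin (3 * n) := ⟨0, by omega⟩
  let _ : MeasurableSpace (NbrLabel n) := ⊤
  refine ⟨constAlgorithm n 0 _ (Sum.inr k), Nat.zero_le _, ?_⟩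
  rintro _ ⟨G, rfl⟩
  have : ∀ s, (constAlgorithm n 0 _ (Sum.inr k)).output (nbrLocalGibbs G).view s ∈
      {σ | σ ∈ (nbrLocalGibbs G).S} := by
    intro s
    simp [nbrLocalGibbs, nbrGibbs, Algorithm.output, constAlgorithm]
  unfold Algorithm.successProb
  rw [(Set.eq_univ_of_forall this : {s | _ ∈ {σ | σ ∈ (nbrLocalGibbs G).S}} = Set.univ)]
  exact probReal_univ

/-! ### Triangle detection -/

section Detection

variable {n c : ℕ}

/-- A degree is one of the n + 1 numbers 0, …, n, so it fits into a single message. -/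
theorem exists_injective_message (hc : 1 ≤ c) :
    ∃ f : Fin (n + 1) → Message n c, Function.Injective f := by
  have : Nonempty (Fin (n + 1) ↪ Message n c) := by
    refine Function.Embedding.nonempty_of_card_le ?_
    simp only [Fintype.card_fin, Fintype.card_fun, Fintype.card_bool]
    exact (Nat.le_pow_clog one_lt_two _).trans
      (Nat.pow_le_pow_right two_pos (Nat.le_mul_of_pos_left _ hc))
  exact this.elim fun f => ⟨f, f.injective⟩

open Classical in
/-- The view of a machine in `nbrLocalGibbs G`, computed from the neighbours of its vertex. -/
noncomputable def nbrView (N : Set (Fin n)) : LocalView n (NbrLabel n) where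
  nbrs := N
  h := n ^ 2
  b := fun _ x => if ∀ w, x = Sum.inl w → w ∈ N then 1 else 0
  A := fun β u x y => if u ∈ N then
    (if ∃ w, x = Sum.inl w ∧ y = Sum.inl w then expNeg β else 1) else 0
  Hv := fun _ => 0
  He := fun u x y => if u ∈ N then (if ∃ w, x = Sum.inl w ∧ y = Sum.inl w then 1 else 0) else 0

theorem nbrView_neighborSet (G : SimpleGraph (Fin n)) (v : Fin n) :
    nbrView (G.neighborSet v) = (nbrLocalGibbs G).view v := by
  simp only [nbrView, LocalGibbs.view, nbrLocalGibbs, nbrGibbs, nbrMRF,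
    SimpleGraph.mem_neighborSet]
  rfl

/-- The partition function at `β = 0`, computed from the encoded degrees. -/
noncomputable def decodeZ (enc : Fin (n + 1) → Message n c) (m : Fin n → Message n c) : ℝ :=
  ∏ v, (3 * (n : ℝ) + (Function.invFun enc (m v) : Fin (n + 1)))

/-- The number of elements of a set of vertices. -/
noncomputable def degreeOf (N : Set (Fin n)) : Fin (n + 1) :=
  ⟨N.ncard, Nat.lt_succ_of_le (by simpa using Set.ncard_le_card N)⟩

theorem decodeZ_degree {enc : Fin (n + 1) → Message n c} (henc : Function.Injective enc)
    (G : SimpleGraph (Fin n)) :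
    decodeZ enc (fun v => enc (degreeOf (G.neighborSet v))) = (nbrGibbs G).Z 0 := by
  rw [nbrGibbs_Z_zero, decodeZ]
  refine Finset.prod_congr rfl fun v _ => ?_
  rw [Function.leftInverse_invFun henc]
  rfl

open Classical in
/-- Triangle detection from an approximation algorithm `P`: in the first round the degrees are
broadcast, then `P` is simulated, and in the last round the answer is broadcast. -/
noncomputable abbrev detector (P : Algorithm n c (LocalView n (NbrLabel n) × ℝ) ℝ) (leader : Fin n)
    (ε : ℝ) (enc : Fin (n + 1) → Message n c) : Algorithm n c (Set (Fin n)) Bool where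
  Seed := P.Seed
  seedLaw := P.seedLaw
  rounds := P.rounds + 2
  send := fun v N s hist w => match hist with
    | [] => enc (degreeOf N)
    -- `m` holds the encoded degrees from the extra first round, and `rest` is exactly the history
    -- that `P` would have. In the last round every machine sends a verdict, but `out` reads only
    -- the leader's.
    | m :: rest => if rest.length < P.rounds then P.send v (nbrView N, decodeZ enc m) s rest w
      else fun _ => decide (P.out v (nbrView N, decodeZ enc m) s rest < (1 - ε) * decodeZ enc m)
  out := fun _ _ _ hist => match hist.getLast? with
    | none => false
    | some m => decide (m leader = fun _ => true)
  measurable_send := by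
    rintro v N (_ | ⟨m, rest⟩) w
    · exact measurable_const
    · by_cases h : rest.length < P.rounds
      · simpa only [h, if_true] using P.measurable_send _ _ _ _
      · simp only [h, if_false]
        refine measurable_pi_iff.mpr fun _ => measurable_to_bool ?_
        have : MeasurableSet {s | P.out v (nbrView N, decodeZ enc m) s rest <
            (1 - ε) * decodeZ enc m} := measurableSet_lt (P.measurable_out _ _ _) measurable_const
        convert this using 1
        ext s
        simp
  measurable_out := fun _ _ _ => measurable_const

theorem Algorithm.length_received {In Out : Type} [MeasurableSpace Out]
    (P : Algorithm n c In Out) (x : Fin n → In) (s : Fin n → P.Seed) (t : ℕ) (v : Fin n) :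
    (P.received x s t v).length = t := by
  induction t with
  | zero => rfl
  | succ t ih => simp [Algorithm.received, ih]

variable {P : Algorithm n c (LocalView n (NbrLabel n) × ℝ) ℝ} {leader : Fin n} {ε : ℝ}
  {enc : Fin (n + 1) → Message n c}

theorem detector_received (henc : Function.Injective enc) (G : SimpleGraph (Fin n))
    (s : Fin n → P.Seed) (t : ℕ) (ht : t ≤ P.rounds) (v : Fin n) :
    (detector P leader ε enc).received (fun v => G.neighborSet v) s (t + 1) v =
      (fun v => enc (degreeOf (G.neighborSet v))) ::
        P.received (fun v => ((nbrLocalGibbs G).view v, (nbrLocalGibbs G).Z 0)) s t v := by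
  induction t generalizing v with
  | zero => rfl
  | succ t ih =>
    rw [Algorithm.received, ih (by omega), List.cons_append, Algorithm.received]
    congr 3
    funext u
    rw [ih (by omega)]
    simp only [Algorithm.length_received]
    rw [if_pos (by omega), decodeZ_degree henc, nbrView_neighborSet]
    rfl

theorem detector_output (henc : Function.Injective enc) (hc : 1 ≤ c) (G : SimpleGraph (Fin n))
    (s : Fin n → P.Seed) (v : Fin n) :
    (detector P leader ε enc).output (fun v => G.neighborSet v) s v = true ↔
      P.output (fun v => ((nbrLocalGibbs G).view v, (nbrLocalGibbs G).Z 0)) s leader <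
        (1 - ε) * (nbrGibbs G).Z 0 := by
  -- With no bits, the all-true and all-false messages would coincide and the verdict could not be
  -- read off.
  have hpos : 0 < c * Nat.clog 2 (n + 1) :=
    Nat.mul_pos hc (Nat.clog_pos one_lt_two (by have := Fin.pos v; omega))
  have hlast : ((detector P leader ε enc).received (fun v => G.neighborSet v) s (P.rounds + 2)
      v).getLast? = some (fun u => (detector P leader ε enc).send u (G.neighborSet u) (s u)
        ((detector P leader ε enc).received (fun v => G.neighborSet v) s (P.rounds + 1) u) v) := by
    rw [Algorithm.received, List.getLast?_append]
    rfl
  have hout : (detector P leader ε enc).output (fun v => G.neighborSet v) s v =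
      (detector P leader ε enc).out v (G.neighborSet v) (s v)
        ((detector P leader ε enc).received (fun v => G.neighborSet v) s (P.rounds + 2) v) := rfl
  rw [hout]
  have hout' : ∀ hist m, hist.getLast? = some m →
      ((detector P leader ε enc).out v (G.neighborSet v) (s v) hist = true ↔
        m leader = fun _ => true) := by
    intro hist m hm
    simp only [hm, decide_eq_true_eq]
  rw [hout' _ _ hlast]
  beta_reduce
  rw [detector_received henc G s _ le_rfl]
  simp only [Algorithm.length_received, lt_irrefl, if_false]
  rw [decodeZ_degree henc, nbrView_neighborSet]
  constructor
  · intro h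
    exact of_decide_eq_true (congrFun h ⟨0, hpos⟩)
  · intro h
    funext _
    exact decide_eq_true h

theorem triangleDetectable_of_approximable {T : ℕ} {p : ℝ} (hc : 1 ≤ c) (hε : 0 < ε)
    (hε' : ε ≤ 1 / (32 * (n : ℝ) ^ 2)) (h : ApproximableKnowingZ0 nbrModel ⊤ ε p n c T) :
    TriangleDetectable p n c (T + 2) := by
  obtain ⟨P, leader, hT, hP⟩ := h
  obtain ⟨enc, henc⟩ := exists_injective_message (n := n) hc
  refine ⟨detector P leader ε enc, Nat.add_le_add_right hT 2, fun G => ?_⟩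
  refine (hP _ ⟨G, rfl⟩).trans ?_
  -- The detector uses the seeds of `P`, so both success events live in one probability space and
  -- inclusion of events suffices.
  refine measureReal_mono (μ := Measure.pi fun _ : Fin n => P.seedLaw) ?_ (measure_ne_top _ _)
  rintro s ⟨h1, h2⟩ v
  rw [detector_output henc hc]
  exact lt_iff_not_cliqueFree hε hε' h1 h2

end Detection

end GibbsCC

theorem mainTheorem5 :
    IsLocalModel nbrModel ∧
    FastMixing nbrModel ∧
    (∀ (n : ℕ) (G : SimpleGraph (Fin n)),
      (nbrLocalGibbs G).Z 0 = ∏ v, (3 * (n : ℝ) + (G.neighborSet v).ncard)) ∧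
    ∀ (n c T : ℕ) (ε p : ℝ), 1 ≤ n → 1 ≤ c → 0 < ε → ε ≤ 1 / (32 * (n : ℝ) ^ 2) →
      ApproximableKnowingZ0 nbrModel ⊤ ε p n c T → TriangleDetectable p n c (T + 2) :=
  ⟨⟨polyBounded_nbrModel, constructible_nbrModel⟩, fastMixing_nbrModel,
    fun _ G => nbrGibbs_Z_zero G,
    fun _ _ _ _ _ _ hc hε hε' h => triangleDetectable_of_approximable hc hε hε' h⟩
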